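/- For a finite group $H$, let $H^2(H,\mathbb{Q}/\mathbb{Z})$ denote group cohomology with trivial action of $H$ on $\mathbb{Q}/\mathbb{Z}$, and let the Bogomolov multiplier of $H$ be \[ B_0(H)=\bigcap_A \operatorname{Ker}\{\operatorname{res}: H^2(H,\mathbb{Q}/\mathbb{Z})\to H^2(A,\mathbb{Q}/\mathbb{Z})\}, \] where $A$ runs over all bicyclic subgroups of $H$ (a group is bicyclic if it is either cyclic or a direct product of two cyclic groups). A finite group $G$ is a Frobenius group with Frobenius kernel $N$ if $G=N\rtimes G_0$, where $N$ and $G_0$ are non-trivial subgroups of $G$, $N$ is normal in $G$, and $gxg^{-1}\neq x$ for all $x\in N\setminus\{1\}$ and all $g\in G_0\setminus\{1\}$. Let $G$ be a Frobenius group with Frobenius kernel $N$. If $B_0(N_p)=0$ for all primes $p$ and all Sylow $p$-subgroups $N_p$ of $N$, then $B_0(G)=0$. -/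

import Mathlib

universe u

/-- The group `ℚ/ℤ` with the trivial action of `G`, as a representation of `G`. The lifts `ULift`
only adjust universes, so that `G` may live in an arbitrary universe. -/
noncomputable abbrev trivQModZ (G : Type u) [Group G] : Rep.{u} (ULift.{u} ℤ) G :=
  Rep.trivial (ULift.{u} ℤ) G (ULift.{u} (AddCircle (1 : ℚ)))

/-- The restriction map `H²(G, ℚ/ℤ) → H²(A, ℚ/ℤ)` for a subgroup `A` of `G`. -/
noncomputable def resH2 {G : Type u} [Group G] (A : Subgroup G) :
    groupCohomology (trivQModZ G) 2 ⟶ groupCohomology (trivQModZ A) 2 :=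
  groupCohomology.map (A := trivQModZ G) (B := trivQModZ A) A.subtype (CategoryTheory.CategoryStruct.id (trivQModZ A)) 2

/-- A group is bicyclic if it is cyclic or a direct product of two cyclic groups. -/
def IsBicyclic (A : Type u) [Group A] : Prop :=
  IsCyclic A ∨ ∃ (C D : Type u) (_ : Group C) (_ : Group D),
    IsCyclic C ∧ IsCyclic D ∧ Nonempty (A ≃* C × D)

/-- The Bogomolov multiplier `B₀(G)`: the classes in `H²(G, ℚ/ℤ)` that restrict to zero on every
bicyclic subgroup of `G`. -/
noncomputable def bogomolovMultiplier (G : Type u) [Group G] :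
    Submodule (ULift.{u} ℤ) (groupCohomology (trivQModZ G) 2) :=
  ⨅ (A : Subgroup G) (_ : IsBicyclic A), LinearMap.ker (resH2 A).hom

/-- `G` is a Frobenius group with kernel `N` and complement `G₀`: `G = N ⋊ G₀` with `N` normal,
both subgroups nontrivial, and `G₀` acting on `N` by conjugation without nontrivial
fixed points. -/
structure IsFrobeniusGroup {G : Type u} [Group G] (N G₀ : Subgroup G) : Prop where
  finite : Finite G
  normal : N.Normal
  isComplement : N.IsComplement' G₀
  kernel_ne_bot : N ≠ ⊥
  complement_ne_bot : G₀ ≠ ⊥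
  fixedPointFree : ∀ x ∈ N, x ≠ 1 → ∀ g ∈ G₀, g ≠ 1 → g * x * g⁻¹ ≠ x

/-! A class that dies on a subgroup of finite index is killed by that index
(`IsTrivCocycle₂.index_smul`). So it suffices to find, for each prime `p`, a subgroup of index prime
to `p` on which a given class of `B₀(G)` vanishes. The orders of `N` and `G₀` are coprime.

If `p` divides `|N|`, a Sylow `p`-subgroup of `N` has index prime to `p` in `G`, and the class
restricts into its Bogomolov multiplier, which is zero by hypothesis.

Otherwise a Sylow `p`-subgroup `P` of `G₀` serves. It acts on `N` without fixed points, so it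
contains no `C_p × C_p`. This forces a cyclic normal subgroup with cyclic quotient, and then `H²(P,
ℚ/ℤ) = 0`: in a central extension of `P` by a divisible group, the kernel meets the commutator
subgroup trivially, so the extension splits. -/

/-! ### Explicit 2-cocycles and the transfer argument. -/

section Cocycles

variable {G : Type*} [Group G] {M : Type*} [AddCommGroup M]

/-- Inhomogeneous 2-cocycles with values in a trivial module. -/
def IsTrivCocycle₂ (f : G → G → M) : Prop :=
  ∀ g h j, f (g * h) j + f g h = f h j + f g (h * j)

/-- Inhomogeneous 2-coboundaries with values in a trivial module. -/
def IsTrivCoboundary₂ (f : G → G → M) : Prop :=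
  ∃ x : G → M, ∀ g h, f g h = x g + x h - x (g * h)

theorem IsTrivCocycle₂.comp {f : G → G → M} (hf : IsTrivCocycle₂ f) {P : Type*} [Group P]
    (φ : P →* G) : IsTrivCocycle₂ fun a b => f (φ a) (φ b) := by
  intro a b c
  simpa using hf (φ a) (φ b) (φ c)

theorem IsTrivCoboundary₂.comp {f : G → G → M} (hf : IsTrivCoboundary₂ f) {P : Type*} [Group P]
    (φ : P →* G) : IsTrivCoboundary₂ fun a b => f (φ a) (φ b) := by
  obtain ⟨x, hx⟩ := hf
  exact ⟨fun a => x (φ a), fun a b => by simp [hx]⟩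

theorem isTrivCoboundary₂_range {f : G → G → M} {P : Type*} [Group P] {φ : P →* G}
    (hφ : Function.Injective φ) (h : IsTrivCoboundary₂ fun a b => f (φ a) (φ b)) :
    IsTrivCoboundary₂ fun a b : φ.range => f a b := by
  have := h.comp (MonoidHom.ofInjective hφ).symm.toMonoidHom
  have key : ∀ a : φ.range, φ ((MonoidHom.ofInjective hφ).symm a) = a := fun a =>
    congrArg Subtype.val ((MonoidHom.ofInjective hφ).apply_symm_apply a)
  simpa [key] using this

/-- If a cocycle becomes a coboundary on a subgroup of finite index, then its multiple by the
index is a coboundary. -/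
theorem IsTrivCocycle₂.index_smul {f : G → G → M} (hf : IsTrivCocycle₂ f) (H : Subgroup G)
    [H.FiniteIndex] (hH : IsTrivCoboundary₂ fun a b : H => f a b) :
    IsTrivCoboundary₂ fun a b => H.index • f a b := by
  classical
  obtain ⟨α, hα⟩ := hH
  have hk : ∀ g : G, ((g : G ⧸ H).out)⁻¹ * g ∈ H := fun g =>
    QuotientGroup.eq.1 (QuotientGroup.out_eq' (g : G ⧸ H))
  let s : G → G := fun g => (g : G ⧸ H).out
  have hs : ∀ g (h : H), s (g * h) = s g := fun g h => by
    simp [s]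
  let κ : G → H := fun g => ⟨(s g)⁻¹ * g, hk g⟩
  have hsκ : ∀ g, s g * κ g = g := fun g => by simp [κ]
  have hκ : ∀ g (h : H), κ (g * h) = κ g * h := fun g h => by
    ext; simp [κ, hs, mul_assoc]
  -- `γ` carries `α` along coset representatives, so as to trivialize `f g h` whenever `h ∈ H`.
  let γ : G → M := fun g => α (κ g) - f (s g) (κ g)
  have hγ : ∀ g (h : H), f g h = γ g + α h - γ (g * h) := by
    intro g h
    have h1 := hf (s g) (κ g) h
    have h2 := hα (κ g) h
    simp only [hsκ] at h1
    simp only [γ, hs, hκ, Subgroup.coe_mul]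
    simp only at h2
    grind
  -- Corrected by `γ`, the cocycle depends on `y` only through its coset. Thus `F` exhibits `f` as a
  -- coboundary with values in functions on `G ⧸ H`, and summing over cosets multiplies `f` by the
  -- index.
  let F : G → G → M := fun g y => f g y + γ (g * y) - γ y
  have hF : ∀ g y (h : H), F g (y * h) = F g y := by
    intro g y h
    have h1 := hf g y h
    have h2 := hγ (g * y) h
    have h3 := hγ y h
    simp only [F, ← mul_assoc]
    grind
  have hF' : ∀ g₁ g₂ y, f g₁ g₂ = F g₂ y + F g₁ (g₂ * y) - F (g₁ * g₂) y := by
    intro g₁ g₂ y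
    have := hf g₁ g₂ y
    simp only [F, ← mul_assoc]
    grind
  have : Fintype (G ⧸ H) := H.fintypeQuotientOfFiniteIndex
  refine ⟨fun g => ∑ q : G ⧸ H, F g q.out, fun g₁ g₂ => ?_⟩
  have e : ∑ q : G ⧸ H, F g₁ q.out = ∑ q : G ⧸ H, F g₁ (g₂ * q.out) := by
    rw [← Equiv.sum_comp (MulAction.toPerm g₂)]
    refine Finset.sum_congr rfl fun q _ => ?_
    have : ((g₂ * q.out : G) : G ⧸ H).out⁻¹ * (g₂ * q.out) ∈ H := hk _
    have h2 : MulAction.toPerm g₂ q = ((g₂ * q.out : G) : G ⧸ H) := by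
      conv_lhs => rw [← QuotientGroup.out_eq' q]
      rfl
    rw [h2, ← hF g₁ _ ⟨_, this⟩]
    simp
  beta_reduce
  rw [e, add_comm (∑ q : G ⧸ H, _), ← Finset.sum_add_distrib, ← Finset.sum_sub_distrib,
    ← Finset.sum_congr rfl fun q _ => hF' g₁ g₂ q.out]
  simp [Subgroup.index, Nat.card_eq_fintype_card]

end Cocycles

/-! ### Commutators in abelian-by-cyclic groups. -/

section Commutators

open scoped commutatorElement

variable {E : Type*} [Group E]

/-- In a group with an abelian normal subgroup `B` and cyclic quotient generated by `x`, every
element of the commutator subgroup is a commutator `⁅b, x⁆` with `b ∈ B`. -/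
theorem exists_commutatorElement_of_mem_commutator (B : Subgroup E) [B.Normal]
    (hB : ∀ a ∈ B, ∀ b ∈ B, a * b = b * a) (x : E) (hx : ∀ e, ∃ i : ℤ, e * x ^ i ∈ B)
    {c : E} (hc : c ∈ commutator E) : ∃ b ∈ B, c = ⁅b, x⁆ := by
  have hn : ∀ b ∈ B, ∀ e : E, e * b * e⁻¹ ∈ B := fun b hb e => ‹B.Normal›.conj_mem b hb e
  have hcm : ∀ b ∈ B, ∀ e : E, ⁅b, e⁆ ∈ B := fun b hb e => by
    have := B.mul_mem hb (hn _ (B.inv_mem hb) e)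
    simpa [commutatorElement_def, mul_assoc] using this
  have hmul : ∀ a ∈ B, ∀ b ∈ B, ∀ e : E, ⁅a * b, e⁆ = ⁅a, e⁆ * ⁅b, e⁆ := by
    intro a ha b hb e
    have := hB _ (hcm b hb e) (e * a⁻¹ * e⁻¹) (hn _ (B.inv_mem ha) e)
    calc ⁅a * b, e⁆ = a * (⁅b, e⁆ * (e * a⁻¹ * e⁻¹)) := by
          simp only [commutatorElement_def]; group
      _ = _ := by rw [this]; simp only [commutatorElement_def]; group
  -- The set of all `⁅b, x⁆` is a subgroup because `b ↦ ⁅b, x⁆` is multiplicative on `B`.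
  let K : Subgroup E :=
    { carrier := {c | ∃ b ∈ B, c = ⁅b, x⁆}
      one_mem' := ⟨1, B.one_mem, by simp⟩
      mul_mem' := by
        rintro _ _ ⟨a, ha, rfl⟩ ⟨b, hb, rfl⟩
        exact ⟨a * b, B.mul_mem ha hb, (hmul a ha b hb x).symm⟩
      inv_mem' := by
        rintro _ ⟨a, ha, rfl⟩
        refine ⟨a⁻¹, B.inv_mem ha, ?_⟩
        have := hmul a ha a⁻¹ (B.inv_mem ha) x
        rw [mul_inv_cancel, commutatorElement_one_left] at this
        exact inv_eq_of_mul_eq_one_right this.symm }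
  have hKB : ∀ k ∈ K, k ∈ B := by
    rintro _ ⟨b, hb, rfl⟩
    exact hcm b hb x
  have hdec : ∀ e : E, ∃ b ∈ B, ∃ i : ℤ, e = b * x ^ i := fun e => by
    obtain ⟨i, hi⟩ := hx e
    exact ⟨_, hi, -i, by group⟩
  have hKn : K.Normal := by
    refine ⟨?_⟩
    rintro _ ⟨b, hb, rfl⟩ e
    obtain ⟨a, ha, i, rfl⟩ := hdec e
    refine ⟨x ^ i * b * (x ^ i)⁻¹, hn b hb _, ?_⟩
    have h1 : x ^ i * ⁅b, x⁆ * (x ^ i)⁻¹ = ⁅x ^ i * b * (x ^ i)⁻¹, x⁆ := by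
      simp only [commutatorElement_def]; group
    have h2 := hB a ha _ (hn _ (hcm b hb x) (x ^ i))
    calc a * x ^ i * ⁅b, x⁆ * (a * x ^ i)⁻¹ = a * (x ^ i * ⁅b, x⁆ * (x ^ i)⁻¹) * a⁻¹ := by group
      _ = _ := by rw [h2, h1]; group
  -- Modulo `K`, the element `x` commutes with `B`; as these generate `E`, the quotient is abelian.
  have hle : commutator E ≤ K := by
    refine Subgroup.Normal.quotient_commutative_iff_commutator_le.1 ⟨⟨fun u v => ?_⟩⟩
    obtain ⟨u, rfl⟩ := QuotientGroup.mk'_surjective K u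
    obtain ⟨v, rfl⟩ := QuotientGroup.mk'_surjective K v
    obtain ⟨a, ha, i, rfl⟩ := hdec u
    obtain ⟨b, hb, j, rfl⟩ := hdec v
    have h0 : ∀ b ∈ B, Commute (QuotientGroup.mk' K b) (QuotientGroup.mk' K x) := fun b hb => by
      rw [← commutatorElement_eq_one_iff_commute, ← map_commutatorElement]
      exact (QuotientGroup.eq_one_iff _).2 ⟨b, hb, rfl⟩
    have h1 : Commute (QuotientGroup.mk' K a) (QuotientGroup.mk' K b) :=
      Commute.map (hB a ha b hb) (QuotientGroup.mk' K)
    simp only [map_mul, map_zpow]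
    exact (h1.mul_right ((h0 a ha).zpow_right j)).mul_left
      (((h0 b hb).symm.zpow_left i).mul_right ((Commute.refl _).zpow_zpow i j))
  exact hle hc

end Commutators

/-! ### Splitting central extensions with divisible kernel. -/

section Extensions

/-- A homomorphism `ι` from a divisible abelian group to `E` has a retraction as soon as only the
identity is mapped into the commutator subgroup. -/
theorem exists_retraction_of_commutator_disjoint {E : Type*} [Group E] {M : Type*} [AddCommGroup M]
    (hM : Module.Baer ℤ M) (ι : Multiplicative M →* E)
    (h : ∀ m, ι m ∈ commutator E → m = 1) :
    ∃ r : E →* Multiplicative M, ∀ m, r (ι m) = m := by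
  let j : M →+ Additive (Abelianization E) := (Abelianization.of.comp ι).toAdditiveRight
  have hj : Function.Injective j := by
    rw [injective_iff_map_eq_zero]
    intro m hm
    refine h (Multiplicative.ofAdd m) ?_
    rw [← Abelianization.ker_of]
    exact hm
  obtain ⟨r, hr⟩ := hM.extension_property_addMonoidHom j hj (AddMonoidHom.id M)
  refine ⟨r.toMultiplicativeRight.comp Abelianization.of, fun m => ?_⟩
  exact DFunLike.congr_fun hr m.toAdd

variable {G : Type*} [Group G] {M : Type*} [AddCommGroup M]

/-- The central extension of `G` by `M` determined by a 2-cocycle. -/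
@[ext]
structure CocycleExtension (f : G → G → M) where
  /-- The coordinate in the kernel. -/
  fst : M
  /-- The coordinate in the quotient. -/
  snd : G

namespace CocycleExtension

variable {f : G → G → M}

theorem map_one_left (hf : IsTrivCocycle₂ f) (g : G) : f 1 g = f 1 1 := by
  have := hf 1 1 g
  simp only [one_mul] at this
  grind

theorem map_one_right (hf : IsTrivCocycle₂ f) (g : G) : f g 1 = f 1 1 := by
  have := hf g 1 1
  simp only [mul_one] at this
  grind

/-- The group structure of the extension. -/
abbrev group (hf : IsTrivCocycle₂ f) : Group (CocycleExtension f) :=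
  letI : Mul (CocycleExtension f) := ⟨fun a b => ⟨a.fst + b.fst + f a.snd b.snd, a.snd * b.snd⟩⟩
  -- The cocycle is not assumed normalized, hence the correction by `f 1 1`.
  letI : One (CocycleExtension f) := ⟨⟨-f 1 1, 1⟩⟩
  letI : Inv (CocycleExtension f) := ⟨fun a => ⟨-a.fst - f a.snd⁻¹ a.snd - f 1 1, a.snd⁻¹⟩⟩
  Group.ofLeftAxioms
    (fun a b c => CocycleExtension.ext
      (by
        have := hf a.snd b.snd c.snd
        change a.fst + b.fst + f a.snd b.snd + c.fst + f (a.snd * b.snd) c.snd =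
          a.fst + (b.fst + c.fst + f b.snd c.snd) + f a.snd (b.snd * c.snd)
        grind)
      (mul_assoc _ _ _))
    (fun a => CocycleExtension.ext
      (by
        change -f 1 1 + a.fst + f 1 a.snd = a.fst
        rw [map_one_left hf a.snd]; abel)
      (one_mul _))
    (fun a => CocycleExtension.ext
      (by
        change -a.fst - f a.snd⁻¹ a.snd - f 1 1 + a.fst + f a.snd⁻¹ a.snd = -f 1 1
        abel)
      (inv_mul_cancel _))

end CocycleExtension

/-- A cocycle on a group with an abelian normal subgroup `A` and cyclic quotient generated by `x` is
a coboundary if `A` is cyclic and commuting pairs `(a, x)` with `a ∈ A` generate cyclic groups. -/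
theorem IsTrivCocycle₂.isTrivCoboundary₂_of_cyclic_by_cyclic {f : G → G → M}
    (hf : IsTrivCocycle₂ f) (hM : Module.Baer ℤ M) (A : Subgroup G) [A.Normal]
    (hA : IsCyclic A) (x : G) (hx : ∀ g, ∃ i : ℤ, g * x ^ i ∈ A)
    (hc : ∀ a ∈ A, Commute a x → ∃ c, a ∈ Subgroup.zpowers c ∧ x ∈ Subgroup.zpowers c) :
    IsTrivCoboundary₂ f := by
  let _ : Group (CocycleExtension f) := CocycleExtension.group hf
  have mul_def : ∀ a b : CocycleExtension f,
    a * b = ⟨a.fst + b.fst + f a.snd b.snd, a.snd * b.snd⟩ := fun _ _ => rfl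
  let π : CocycleExtension f →* G :=
    { toFun := CocycleExtension.snd, map_one' := rfl, map_mul' := fun _ _ => rfl }
  let ι : Multiplicative M →* CocycleExtension f :=
    { toFun := fun m => ⟨m.toAdd - f 1 1, 1⟩
      map_one' := CocycleExtension.ext (zero_sub _) rfl
      map_mul' := fun a b => by
        rw [mul_def]
        ext
        · simp only [toAdd_mul, sub_add_sub_comm]; abel
        · simp }
  have hιc : ∀ m e, Commute (ι m) e := fun m e => by
    change ι m * e = e * ι m
    rw [mul_def, mul_def]
    ext
    · simp [ι, CocycleExtension.map_one_left hf, CocycleExtension.map_one_right hf, add_comm]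
    · simp [ι]
  have hιπ : ∀ e, π e = 1 → ∃ m, e = ι m := fun e he =>
    ⟨Multiplicative.ofAdd (e.fst + f 1 1), CocycleExtension.ext (by simp [ι]) he⟩
  -- A central extension of a cyclic group is abelian.
  have hcyc : ∀ c (a b : CocycleExtension f), π a ∈ Subgroup.zpowers (π c) →
      π b ∈ Subgroup.zpowers (π c) → Commute a b := by
    rintro c a b ⟨i, hi⟩ ⟨j, hj⟩
    have key : ∀ (a : CocycleExtension f) (i : ℤ), π c ^ i = π a → ∃ m, a = ι m * c ^ i := by
      intro a i hi
      obtain ⟨m, hm⟩ := hιπ (a * (c ^ i)⁻¹) (by simp [← hi])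
      exact ⟨m, by rw [← hm]; group⟩
    obtain ⟨m, rfl⟩ := key a i hi
    obtain ⟨n, rfl⟩ := key b j hj
    exact ((hιc m _)).mul_left ((hιc n _).symm.mul_right ((Commute.refl c).zpow_zpow i j))
  -- A kernel element in the commutator subgroup is a single `⁅b, ⟨0, x⟩⁆`. Since it lies over `1`,
  -- `π b` commutes with `x`; both then lie in one cyclic group, whose preimage is abelian, so the
  -- commutator is trivial.
  obtain ⟨r, hr⟩ := exists_retraction_of_commutator_disjoint hM ι fun m hm => by
    obtain ⟨c, hcA⟩ := hA.exists_generator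
    have hcA' : ∀ a ∈ A, a ∈ Subgroup.zpowers (c : G) := fun a ha => by
      simpa [Subgroup.mem_zpowers_iff, Subtype.ext_iff] using hcA ⟨a, ha⟩
    obtain ⟨b, hb, hbm⟩ := exists_commutatorElement_of_mem_commutator (A.comap π)
      (fun a ha b hb => hcyc ⟨0, c⟩ a b
        (hcA' _ ha) (hcA' _ hb)) ⟨0, x⟩
      (fun e => (hx (π e)).imp fun i hi => by
        rw [Subgroup.mem_comap, map_mul, map_zpow]; exact hi) hm
    have h1 : Commute (π b) x := by
      rw [← commutatorElement_eq_one_iff_commute]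
      have := congrArg π hbm
      rw [map_commutatorElement] at this
      exact this.symm
    obtain ⟨d, hd1, hd2⟩ := hc _ hb h1
    have h2 : Commute b ⟨0, x⟩ := hcyc ⟨0, d⟩ _ _ hd1 hd2
    rw [commutatorElement_eq_one_iff_commute.2 h2] at hbm
    have h3 := congrArg CocycleExtension.fst hbm
    have h4 : Multiplicative.toAdd m - f 1 1 = -f 1 1 := h3
    simpa [sub_eq_neg_self] using h4
  refine ⟨fun g => (r ⟨0, g⟩).toAdd, fun g h => ?_⟩
  have h1 : (⟨0, g⟩ * ⟨0, h⟩ : CocycleExtension f) =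
      ι (Multiplicative.ofAdd (f g h)) * ⟨0, g * h⟩ := by
    rw [mul_def, mul_def]
    ext
    · simp [ι, CocycleExtension.map_one_left hf]
    · simp [ι]
  have h2 := congrArg (fun e => (r e).toAdd) h1
  simp only [map_mul, hr, toAdd_mul, toAdd_ofAdd] at h2
  rw [h2]; abel

end Extensions

/-! ### Structure of `p`-groups with a unique subgroup of order `p`. -/

section PGroups

/-- A finite abelian `p`-group with at most one subgroup of order `p` is cyclic. -/
theorem IsPGroup.isCyclic_of_forall_mem_zpowers {p : ℕ} [hp : Fact p.Prime] {B : Type*}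
    [CommGroup B] [Finite B] (hB : IsPGroup p B)
    (hU : ∀ z y : B, z ^ p = 1 → z ≠ 1 → y ^ p = 1 → y ∈ Subgroup.zpowers z) : IsCyclic B := by
  obtain ⟨a, ha⟩ := Monoid.exists_orderOf_eq_exponent (Monoid.ExponentExists.of_finite (G := B))
  obtain ⟨k, hk⟩ := (isPGroup_iff_exponent_eq_pow).1 hB
  refine ⟨a, fun b => ?_⟩
  obtain ⟨j, hj⟩ := isPGroup_iff_pow_pow_eq_one.1 hB b
  rcases k with _ | k
  · have : b = 1 := by simpa [hk] using Monoid.pow_exponent_eq_one b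
    exact this ▸ one_mem (Subgroup.zpowers a)
  induction j generalizing b with
  | zero => rw [pow_zero, pow_one] at hj; exact hj ▸ one_mem (Subgroup.zpowers a)
  | succ j ih =>
    obtain ⟨m, hm⟩ := ih (b ^ p) (by rw [← pow_mul, ← pow_succ', hj])
    -- As `b ^ p = a ^ m` is killed by `p ^ k`, `p` divides `m`. So `b` differs from a power of `a`
    -- by an element killed by `p`, which lies in the order-`p` subgroup of `⟨a⟩`.
    have h1 : a ^ (m * (p ^ k : ℕ)) = 1 := by
      rw [zpow_mul, zpow_natCast]
      simp only at hm
      rw [hm, ← pow_mul, ← pow_succ', ← hk, Monoid.pow_exponent_eq_one]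
    have h2 : (p : ℤ) ∣ m := by
      rw [← orderOf_dvd_iff_zpow_eq_one, ha, hk, pow_succ', Nat.cast_mul] at h1
      exact Int.dvd_of_mul_dvd_mul_right (by exact_mod_cast (pow_pos hp.out.pos k).ne') h1
    obtain ⟨m, rfl⟩ := h2
    have hz1 : (a ^ p ^ k) ^ p = 1 := by
      rw [← pow_mul, ← pow_succ, ← hk, Monoid.pow_exponent_eq_one]
    have hz2 : a ^ p ^ k ≠ 1 := by
      intro h
      have := Nat.le_of_dvd (pow_pos hp.out.pos k) (orderOf_dvd_of_pow_eq_one h)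
      rw [ha, hk] at this
      exact absurd this (not_le.2 (Nat.pow_lt_pow_right hp.out.one_lt k.lt_succ_self))
    have h3 := hU (a ^ p ^ k) (b * (a ^ m)⁻¹) hz1 hz2 (by
      rw [mul_pow, ← hm, inv_pow, ← zpow_natCast, ← zpow_mul, mul_comm m, mul_inv_cancel])
    have h4 : Subgroup.zpowers (a ^ p ^ k) ≤ Subgroup.zpowers a := by
      rw [Subgroup.zpowers_le]; exact Subgroup.npow_mem_zpowers a _
    have := mul_mem (h4 h3) (Subgroup.zpow_mem_zpowers a m)
    rwa [inv_mul_cancel_right] at this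

/-- A finite `p`-group has a self-centralizing abelian normal subgroup. -/
theorem IsPGroup.exists_normal_centralizer_le {p : ℕ} [hp : Fact p.Prime] {P : Type*}
    [Group P] [Finite P] (hP : IsPGroup p P) :
    ∃ A : Subgroup P, A.Normal ∧ (∀ a ∈ A, ∀ b ∈ A, a * b = b * a) ∧
      ∀ g, (∀ a ∈ A, g * a = a * g) → g ∈ A := by
  obtain ⟨A, ⟨hAn, hAc⟩, hmax⟩ := Set.Finite.exists_maximal
    (Set.toFinite {A : Subgroup P | A.Normal ∧ ∀ a ∈ A, ∀ b ∈ A, a * b = b * a})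
    ⟨⊥, inferInstance, by simp⟩
  refine ⟨A, hAn, hAc, ?_⟩
  -- If the centralizer of the maximal `A` were larger, its image in `P ⧸ A` would contain a
  -- nontrivial central element `π x`; adjoining `x` would enlarge `A`.
  by_contra! hcon
  obtain ⟨c, hc, hcA⟩ := hcon
  let π := QuotientGroup.mk' A
  let C : Subgroup (P ⧸ A) := (Subgroup.centralizer (A : Set P)).map π
  have hCn : C.Normal := Subgroup.Normal.map inferInstance π (QuotientGroup.mk'_surjective A)
  have hC1 : Nontrivial C := by
    refine ⟨⟨⟨π c, c, ?_, rfl⟩, 1, ?_⟩⟩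
    · exact Subgroup.mem_centralizer_iff.2 fun a ha => (hc a ha).symm
    · intro h
      exact hcA ((QuotientGroup.eq_one_iff c).1 (congrArg Subtype.val h))
  have hpC : p ∣ Nat.card C := by
    obtain ⟨n, hn0, hn⟩ := ((hP.to_quotient A).to_subgroup C).nontrivial_iff_card.1 hC1
    exact hn ▸ dvd_pow_self p hn0.ne'
  let _ : MulDistribMulAction (P ⧸ A) C :=
    MulDistribMulAction.compHom C (MulAut.conjNormal (H := C))
  obtain ⟨⟨_, x, hx, rfl⟩, hfix, hne⟩ :=
    (hP.to_quotient A).exists_fixed_point_of_prime_dvd_card_of_fixed_point C hpC (a := 1)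
      (fun g => smul_one g)
  have hcen : ∀ g : P ⧸ A, g * π x * g⁻¹ = π x := fun g => congrArg Subtype.val (hfix g)
  have hxA : x ∉ A := fun h => hne (Subtype.ext ((QuotientGroup.eq_one_iff x).2 h).symm)
  rw [SetLike.mem_coe, Subgroup.mem_centralizer_iff] at hx
  let B : Subgroup P := (Subgroup.zpowers (π x)).comap π
  have hB : ∀ g ∈ B, ∃ a ∈ A, ∃ i : ℤ, g = a * x ^ i := by
    rintro g ⟨i, hi⟩
    refine ⟨g * (x ^ i)⁻¹, ?_, i, by group⟩
    rw [← QuotientGroup.eq_one_iff]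
    change π (g * (x ^ i)⁻¹) = 1
    simp only at hi
    rw [map_mul, map_inv, map_zpow, hi, mul_inv_cancel]
  have hAB : A ≤ B := fun a ha => by
    rw [Subgroup.mem_comap, show π a = 1 from (QuotientGroup.eq_one_iff a).2 ha]
    exact one_mem _
  have hBn : B.Normal := by
    have : (Subgroup.zpowers (π x)).Normal := ⟨by
      rintro _ ⟨i, rfl⟩ g
      refine ⟨i, ?_⟩
      simp only
      rw [← conj_zpow, hcen]⟩
    exact this.comap π
  have hBc : ∀ a ∈ B, ∀ b ∈ B, a * b = b * a := by
    intro g hg h hh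
    obtain ⟨a, ha, i, rfl⟩ := hB g hg
    obtain ⟨b, hb, j, rfl⟩ := hB h hh
    have hax : ∀ a ∈ A, Commute a x := fun a ha => hx a ha
    have hab : Commute a b := hAc a ha b hb
    exact (hab.mul_right ((hax a ha).zpow_right j)).mul_left
      ((((hax b hb).symm.zpow_left i)).mul_right ((Commute.refl x).zpow_zpow i j))
  exact hxA (hmax ⟨hBn, hBc⟩ hAB (Subgroup.mem_zpowers _))

/-- In a `2`-group with a unique involution, an element `y` with `y ^ 2 ∈ ⟨a⟩` acting on `⟨a⟩` by
raising to a power `1 + 4 * t` either centralizes `a` or lies in `⟨a⟩`. -/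
theorem mem_of_unique_involution {P : Type*} [Group P] {a : P} {n : ℕ} (ha : orderOf a = 2 ^ n)
    (hn : n ≠ 0) (hU : ∀ z y : P, Commute z y → z ^ 2 = 1 → z ≠ 1 → y ^ 2 = 1 →
      y ∈ Subgroup.zpowers z) {y : P} (hy : y ^ 2 ∈ Subgroup.zpowers a) {t : ℤ}
    (hya : y * a * y⁻¹ = a ^ (1 + 4 * t)) :
    y ∈ Subgroup.centralizer {a} ∨ y ∈ Subgroup.zpowers a := by
  rw [or_iff_not_imp_left]
  intro hyc
  have h4 : ¬ (2 ^ n : ℤ) ∣ 4 * t := by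
    intro h
    apply hyc
    have : a ^ (4 * t) = 1 := by
      rw [← orderOf_dvd_iff_zpow_eq_one, ha]; exact_mod_cast h
    rw [zpow_add, this, zpow_one, mul_one] at hya
    rw [Subgroup.mem_centralizer_singleton_iff]
    exact mul_inv_eq_iff_eq_mul.1 hya
  have hyz : ∀ i : ℤ, y * a ^ i * y⁻¹ = a ^ ((1 + 4 * t) * i) := fun i => by
    rw [← conj_zpow, hya, zpow_mul]
  obtain ⟨r, hr⟩ := hy
  simp only at hr
  -- `y` commutes with `y ^ 2 = a ^ r`, so `2 ^ n ∣ 4 * t * r`; an odd `r` would contradict `h4`.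
  have hr2 : (2 : ℤ) ∣ r := by
    have h1 : a ^ ((1 + 4 * t) * r) = a ^ r := by
      rw [← hyz, hr]; group
    have h2 : a ^ (4 * t * r) = 1 := by
      rw [show 4 * t * r = (1 + 4 * t) * r - r by ring, zpow_sub, h1, mul_inv_cancel]
    rw [← orderOf_dvd_iff_zpow_eq_one, ha] at h2
    push_cast at h2
    by_contra hodd
    have : IsCoprime ((2 : ℤ) ^ n) r :=
      (Int.isCoprime_iff_gcd_eq_one.2 (by
        have := (Int.prime_two.coprime_iff_not_dvd).2 hodd
        exact Int.isCoprime_iff_gcd_eq_one.1 this)).pow_left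
    exact h4 (this.dvd_of_dvd_mul_right h2)
  obtain ⟨s, rfl⟩ := hr2
  have hcop : IsCoprime (1 + 2 * t) ((2 : ℤ) ^ n) :=
    IsCoprime.pow_right ⟨1, -t, by ring⟩
  obtain ⟨u, v, huv⟩ := hcop
  -- Solves `(2 + 4 * t) * i + 2 * s ≡ 0` modulo `2 ^ n`, the left side being the exponent of `a` in
  -- `(a ^ i * y) ^ 2`.
  let i : ℤ := -s * u
  have hsq : (a ^ i * y) ^ 2 = 1 := by
    have h1 : (a ^ i * y) ^ 2 = a ^ i * (y * a ^ i * y⁻¹) * y ^ 2 := by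
      simp [pow_two, mul_assoc]
    rw [h1, hyz, ← hr, ← zpow_add, ← zpow_add, ← orderOf_dvd_iff_zpow_eq_one, ha]
    refine ⟨2 * s * v, ?_⟩
    push_cast
    simp only [i]
    linear_combination (-2 * s) * huv
  obtain ⟨m, rfl⟩ := Nat.exists_eq_succ_of_ne_zero hn
  have hz1 : (a ^ 2 ^ m) ^ 2 = 1 := by
    rw [← pow_mul, ← pow_succ, ← ha, pow_orderOf_eq_one]
  have hz2 : a ^ 2 ^ m ≠ 1 := by
    intro h
    have := Nat.le_of_dvd (by positivity) (orderOf_dvd_of_pow_eq_one h)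
    rw [ha] at this
    exact absurd this (not_le.2 (Nat.pow_lt_pow_right one_lt_two m.lt_succ_self))
  have hzy : Commute (a ^ 2 ^ m) y := by
    have h1 := hyz (2 ^ m : ℕ)
    have h2 : a ^ ((1 + 4 * t) * (2 ^ m : ℕ)) = a ^ ((2 ^ m : ℕ) : ℤ) := by
      rw [add_mul, one_mul, zpow_add, show 4 * t * ((2 ^ m : ℕ) : ℤ) =
        ((2 ^ (m + 1) : ℕ) : ℤ) * (2 * t) by push_cast; ring, zpow_mul a _ (2 * t),
        zpow_natCast a (2 ^ (m + 1)),
        ← ha, pow_orderOf_eq_one, one_zpow, mul_one]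
    rw [h2, zpow_natCast] at h1
    exact (mul_inv_eq_iff_eq_mul.1 h1).symm
  have hmem := hU _ _ ((Commute.refl a).pow_left _ |>.zpow_right i |>.mul_right hzy) hz1 hz2 hsq
  have h4 : Subgroup.zpowers (a ^ 2 ^ m) ≤ Subgroup.zpowers a := by
    rw [Subgroup.zpowers_le]; exact Subgroup.npow_mem_zpowers a _
  exact (Subgroup.mul_mem_cancel_left _ (Subgroup.zpow_mem_zpowers a i)).1 (h4 hmem)

/-- In a finite `p`-group with a unique subgroup of order `p`, there is a cyclic normal subgroup
with cyclic quotient. -/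
theorem IsPGroup.exists_cyclic_normal_cyclic_quotient {p : ℕ} [hp : Fact p.Prime] {P : Type*}
    [Group P] [Finite P] (hP : IsPGroup p P)
    (hU : ∀ z y : P, Commute z y → z ^ p = 1 → z ≠ 1 → y ^ p = 1 → y ∈ Subgroup.zpowers z) :
    ∃ A : Subgroup P, A.Normal ∧ IsCyclic A ∧ ∃ x, ∀ g, ∃ i : ℤ, g * x ^ i ∈ A := by
  obtain ⟨A, hAn, hAc, hcen⟩ := hP.exists_normal_centralizer_le
  have hA : IsCyclic A := by
    let _ : CommGroup A := { mul_comm := fun a b => Subtype.ext (hAc a a.2 b b.2) }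
    refine (hP.to_subgroup A).isCyclic_of_forall_mem_zpowers fun z y hz hz1 hy => ?_
    obtain ⟨i, hi⟩ := hU z y (hAc z z.2 y y.2) (by simpa using congrArg Subtype.val hz)
      (by simpa using hz1) (by simpa using congrArg Subtype.val hy)
    exact ⟨i, Subtype.ext hi⟩
  refine ⟨A, hAn, hA, ?_⟩
  obtain ⟨n, hn⟩ := IsPGroup.iff_card.1 (hP.to_subgroup A)
  let _ : MulDistribMulAction P A := MulDistribMulAction.compHom A (MulAut.conjNormal (H := A))
  have hsmul : ∀ (g : P) (x : A), ((g • x : A) : P) = g * x * g⁻¹ := fun g x => rfl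
  -- Conjugation on the cyclic group `A`. As `A` is self-centralizing, the kernel lies in `A`, so a
  -- cyclic image suffices.
  let ψ : P →* (ZMod (p ^ n))ˣ :=
    (MulDistribMulAction.toMonoidHomZModOfIsCyclic A P hn).toHomUnits
  have hψ : ∀ (g : P) (k : ℤ), (ψ g : ZMod (p ^ n)) = k → ∀ x : A, g * x * g⁻¹ = (x : P) ^ k :=
    fun g k h x => by
      simpa [hsmul] using congrArg Subtype.val
        (MulDistribMulAction.toMonoidHomZModOfIsCyclic_apply hn g x k h)
  have hker : ∀ g, ψ g = 1 → g ∈ A := fun g hg => hcen g fun a ha => by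
    have := hψ g 1 (by simp [hg]) ⟨a, ha⟩
    simpa [mul_inv_eq_iff_eq_mul] using this
  suffices hcyc : IsCyclic ψ.range by
    obtain ⟨⟨_, x, rfl⟩, hx⟩ := hcyc.exists_generator
    refine ⟨x, fun g => ?_⟩
    obtain ⟨i, hi⟩ := hx ⟨ψ g, g, rfl⟩
    have hi' : ψ x ^ i = ψ g := congrArg Subtype.val hi
    exact ⟨-i, hker _ (by rw [map_mul, map_zpow, zpow_neg, hi', mul_inv_cancel])⟩
  by_cases hp2 : p = 2
  swap
  · have := ZMod.isCyclic_units_of_prime_pow p hp.out hp2 n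
    infer_instance
  subst hp2
  by_cases hn2 : n ≤ 2
  · have := (ZMod.isCyclic_units_two_pow_iff n).2 hn2
    infer_instance
  have h4 : 4 ∣ 2 ^ n := pow_dvd_pow 2 (show 2 ≤ n by omega)
  -- For `n ≥ 3` the unit group is not cyclic, but the image of `ψ` embeds in `(ZMod 4)ˣ`. Otherwise
  -- some `y` acts with order 2 by an exponent `1 + 4 * t`, which `mem_of_unique_involution`
  -- excludes.
  let ρ : (ZMod (2 ^ n))ˣ →* (ZMod 4)ˣ := Units.map (ZMod.castHom h4 (ZMod 4)).toMonoidHom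
  have := ZMod.isCyclic_units_four
  refine isCyclic_of_injective (ρ.comp ψ.range.subtype) ?_
  rw [injective_iff_map_eq_one]
  rintro ⟨_, g, rfl⟩ hg
  replace hg : ρ (ψ g) = 1 := hg
  by_contra hne
  replace hne : ψ g ≠ 1 := fun h => hne (Subtype.ext h)
  obtain ⟨m, hm⟩ := isPGroup_iff_orderOf_dvd_pow.1 (hP.of_surjective ψ.rangeRestrict
    ψ.rangeRestrict_surjective) (ψ.rangeRestrict g)
  obtain ⟨y, hyρ, hy1, hy2⟩ : ∃ y, ρ (ψ y) = 1 ∧ ψ y ≠ 1 ∧ ψ (y ^ 2) = 1 := by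
    have hgm : ψ g ^ 2 ^ m = 1 := by
      simpa using congrArg Subtype.val (orderOf_dvd_iff_pow_eq_one.1 hm)
    clear hm
    induction m generalizing g with
    | zero => exact absurd (by simpa using hgm) hne
    | succ m ih =>
      by_cases h : ψ (g ^ 2) = 1
      · exact ⟨g, hg, hne, h⟩
      · exact ih (g ^ 2) (by simp [hg]) h (by rw [map_pow, ← pow_mul, ← pow_succ', hgm])
  obtain ⟨k, hk⟩ := ZMod.intCast_surjective (ψ y : ZMod (2 ^ n))
  obtain ⟨t, rfl⟩ : ∃ t : ℤ, k = 1 + 4 * t := by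
    have h1 : ZMod.castHom h4 (ZMod 4) (ψ y : ZMod (2 ^ n)) = 1 := congrArg Units.val hyρ
    rw [← hk, map_intCast] at h1
    have h2 : ((4 : ℕ) : ℤ) ∣ k - 1 := by
      rw [← ZMod.intCast_zmod_eq_zero_iff_dvd]; simp [h1]
    obtain ⟨t, ht⟩ := h2
    exact ⟨t, by push_cast at ht; linarith⟩
  obtain ⟨a, ha⟩ := hA.exists_generator
  have ha' : ∀ b ∈ A, b ∈ Subgroup.zpowers (a : P) := fun b hb => by
    obtain ⟨i, hi⟩ := ha ⟨b, hb⟩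
    exact ⟨i, congrArg Subtype.val hi⟩
  have hord : orderOf (a : P) = 2 ^ n := by
    rw [Subgroup.orderOf_coe, ← hn, orderOf_eq_card_of_forall_mem_zpowers ha]
  have hyA : y ∈ A := by
    rcases mem_of_unique_involution hord (by omega) hU (ha' _ (hker _ hy2)) (hψ y _ hk.symm a)
      with h | h
    · refine hcen y fun b hb => ?_
      obtain ⟨i, rfl⟩ := ha' b hb
      rw [Subgroup.mem_centralizer_singleton_iff] at h
      exact (Commute.zpow_right (show Commute y a from h) i)
    · obtain ⟨i, rfl⟩ := h
      exact zpow_mem a.2 i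
  refine hy1 (Units.ext ?_)
  have h1 := hψ y _ hk.symm a
  rw [hAc y hyA a a.2, mul_inv_cancel_right, zpow_add, zpow_one, left_eq_mul,
    ← orderOf_dvd_iff_zpow_eq_one, hord, ← ZMod.intCast_zmod_eq_zero_iff_dvd] at h1
  rw [← hk, Int.cast_add, h1, Int.cast_one, add_zero, Units.val_one]

/-- Cocycles with divisible coefficients on a finite `p`-group with a unique subgroup of order `p`
are coboundaries. -/
theorem IsPGroup.isTrivCoboundary₂ {p : ℕ} [hp : Fact p.Prime] {P : Type*}
    [Group P] [Finite P] (hP : IsPGroup p P)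
    (hU : ∀ z y : P, Commute z y → z ^ p = 1 → z ≠ 1 → y ^ p = 1 → y ∈ Subgroup.zpowers z)
    {M : Type*} [AddCommGroup M] (hM : Module.Baer ℤ M) {f : P → P → M} (hf : IsTrivCocycle₂ f) :
    IsTrivCoboundary₂ f := by
  obtain ⟨A, hAn, hA, x, hx⟩ := hP.exists_cyclic_normal_cyclic_quotient hU
  refine hf.isTrivCoboundary₂_of_cyclic_by_cyclic hM A hA x hx fun a _ hax => ?_
  let B := Subgroup.closure {a, x}
  have hB : IsMulCommutative B := Subgroup.isMulCommutative_closure (by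
    rintro u (rfl | rfl) v (rfl | rfl)
    exacts [rfl, hax, hax.symm, rfl])
  have hcyc : IsCyclic B := by
    let _ : CommGroup B := { mul_comm := hB.is_comm.comm }
    refine (hP.to_subgroup B).isCyclic_of_forall_mem_zpowers fun z y hz hz1 hy => ?_
    obtain ⟨i, hi⟩ := hU z y (congrArg Subtype.val (mul_comm z y))
      (by simpa using congrArg Subtype.val hz)
      (by simpa using hz1) (by simpa using congrArg Subtype.val hy)
    exact ⟨i, Subtype.ext hi⟩
  obtain ⟨c, hc⟩ := hcyc.exists_generator
  have key : ∀ b ∈ B, b ∈ Subgroup.zpowers (c : P) := fun b hb => by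
    obtain ⟨i, hi⟩ := hc ⟨b, hb⟩
    exact ⟨i, congrArg Subtype.val hi⟩
  exact ⟨c, key a (Subgroup.subset_closure (by simp)), key x (Subgroup.subset_closure (by simp))⟩

end PGroups

/-! ### Fixed-point-free actions of `p`-groups. -/

section FixedPointFree

open scoped Pointwise

/-- If commuting elements `z`, `y` of order `p` act on a nontrivial finite abelian group of order
prime to `p`, and no nontrivial product `z ^ i * y ^ j` has nontrivial fixed points, then `y` is a
power of `z`. -/
theorem mem_zpowers_of_fixedPointFree_comm {p : ℕ} [hp : Fact p.Prime] {P W : Type*} [Group P]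
    [CommGroup W] [Finite W] [Nontrivial W] (φ : P →* Monoid.End W)
    (hfix : ∀ g : P, g ≠ 1 → ∀ w : W, φ g w = w → w = 1) (hpW : ¬ p ∣ Nat.card W)
    {z y : P} (hzy : Commute z y) (hz : z ^ p = 1) (hz1 : z ≠ 1) (hy : y ^ p = 1) :
    y ∈ Subgroup.zpowers z := by
  by_contra hcon
  -- The norm of `w` under `⟨g⟩` is fixed by `g`, hence trivial.
  have hnorm : ∀ g : P, g ^ p = 1 → g ≠ 1 → ∀ w : W, ∏ i ∈ Finset.range p, φ (g ^ i) w = 1 := by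
    intro g hg hg1 w
    refine hfix g hg1 _ ?_
    have h1 := Finset.prod_range_succ (fun i => φ (g ^ i) w) p
    have h2 := Finset.prod_range_succ' (fun i => φ (g ^ i) w) p
    rw [h1, hg, pow_zero] at h2
    rw [map_prod]
    simpa [pow_succ'] using (mul_right_cancel h2).symm
  obtain ⟨w, hw⟩ := exists_ne (1 : W)
  have hwp : w ^ p ≠ 1 := fun h => by
    have h1 := orderOf_eq_prime h hw
    exact hpW (h1 ▸ orderOf_dvd_natCard w)
  apply hwp
  -- Each row is a norm for `z ^ i * y`, hence trivial. By columns, `j = 0` contributes `w ^ p` and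
  -- every other column is a norm for `z ^ j`, so `w ^ p = 1`.
  have h1 : ∏ i ∈ Finset.range p, ∏ j ∈ Finset.range p, φ ((z ^ i * y) ^ j) w = 1 := by
    refine Finset.prod_eq_one fun i _ => hnorm _ ?_ ?_ w
    · rw [(hzy.pow_left i).mul_pow, hy, mul_one, ← pow_mul, mul_comm, pow_mul, hz, one_pow]
    · intro h
      exact hcon ((Subgroup.mul_mem_cancel_left _ (Subgroup.npow_mem_zpowers z i)).1
        (h ▸ one_mem _))
  rw [Finset.prod_comm, ← Nat.sub_add_cancel hp.out.one_le, Finset.prod_range_succ',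
    Nat.sub_add_cancel hp.out.one_le] at h1
  rw [Finset.prod_eq_one] at h1
  · simpa using h1
  intro j hj
  have hj' : j + 1 < p := by have := Finset.mem_range.1 hj; omega
  have h2 := hnorm (z ^ (j + 1)) (by rw [← pow_mul, mul_comm, pow_mul, hz, one_pow])
    (fun h => by
      have h3 := Nat.le_of_dvd j.succ_pos (orderOf_dvd_of_pow_eq_one h)
      rw [orderOf_eq_prime hz hz1] at h3
      omega) (φ (y ^ (j + 1)) w)
  rw [← h2]
  refine Finset.prod_congr rfl fun i _ => ?_
  rw [(hzy.pow_left i).mul_pow, map_mul, ← pow_mul, ← pow_mul, mul_comm i]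
  rfl

/-- A finite `p`-group acting without nontrivial fixed points on a nontrivial finite group of order
prime to `p` has a unique subgroup of order `p`. -/
theorem IsPGroup.mem_zpowers_of_fixedPointFree {p : ℕ} [hp : Fact p.Prime] {P N : Type*} [Group P]
    [Group N] [Finite N] [Nontrivial N] [MulDistribMulAction P N] (hP : IsPGroup p P) [Finite P]
    (hfix : ∀ g : P, g ≠ 1 → ∀ x : N, g • x = x → x = 1) (hpN : ¬ p ∣ Nat.card N)
    {z y : P} (hzy : Commute z y) (hz : z ^ p = 1) (hz1 : z ≠ 1) (hy : y ^ p = 1) :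
    y ∈ Subgroup.zpowers z := by
  obtain ⟨q, hq, hqN⟩ := Nat.exists_prime_and_dvd (Finite.one_lt_card (α := N)).ne'
  have : Fact q.Prime := ⟨hq⟩
  -- The number of Sylow `q`-subgroups divides `|N|`, so it is prime to `p` and `P` stabilizes one.
  -- Its center is the abelian group needed.
  obtain ⟨Q, hQq, hQ1, hQs⟩ : ∃ Q : Subgroup N, IsPGroup q Q ∧ Nontrivial Q ∧
      ∀ (g : P) (x : N), x ∈ Q → g • x ∈ Q := by
    obtain ⟨Q, hQ⟩ := hP.nonempty_fixed_point_of_prime_not_dvd_card (Sylow q N) fun h =>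
      hpN (h.trans ((Sylow.card_dvd_index (default : Sylow q N)).trans (Subgroup.index_dvd_card _)))
    refine ⟨Q, Q.2, ?_, fun g x hx => ?_⟩
    · have := Q.dvd_card_of_dvd_card hqN
      exact Finite.one_lt_card_iff_nontrivial.1
        (hq.one_lt.trans_le (Nat.le_of_dvd Nat.card_pos this))
    · have h1 : g • (Q : Subgroup N) = Q := congrArg Sylow.toSubgroup (hQ g)
      rw [← h1]
      exact Subgroup.smul_mem_pointwise_smul _ _ _ hx
  let _ : CommGroup (Subgroup.center Q) :=
    { mul_comm := fun a b => Subtype.ext (Subgroup.mem_center_iff.1 b.2 a) }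
  have hW1 : Nontrivial (Subgroup.center Q) := hQq.center_nontrivial
  let φQ : P →* Monoid.End Q :=
    { toFun := fun g =>
        { toFun := fun x => ⟨g • (x : N), hQs g x x.2⟩
          map_one' := Subtype.ext (smul_one g)
          map_mul' := fun x y => Subtype.ext (smul_mul' g (x : N) y) }
      map_one' := MonoidHom.ext fun x => Subtype.ext (one_smul P (x : N))
      map_mul' := fun g h => MonoidHom.ext fun x => Subtype.ext (mul_smul g h (x : N)) }
  have hφ : ∀ g h (x : Q), φQ g (φQ h x) = φQ (g * h) x := fun g h x => by rw [map_mul]; rfl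
  have hWs : ∀ g (x : Q), x ∈ Subgroup.center Q → φQ g x ∈ Subgroup.center Q := by
    intro g x hx
    rw [Subgroup.mem_center_iff] at hx ⊢
    intro u
    have h1 : u = φQ g (φQ g⁻¹ u) := by rw [hφ, mul_inv_cancel, map_one]; rfl
    rw [h1, ← map_mul, hx, map_mul]
  let φ : P →* Monoid.End (Subgroup.center Q) :=
    { toFun := fun g =>
        { toFun := fun x => ⟨φQ g (x : Q), hWs g x x.2⟩
          map_one' := Subtype.ext (map_one (φQ g))
          map_mul' := fun x y => Subtype.ext (map_mul (φQ g) (x : Q) y) }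
      map_one' := MonoidHom.ext fun x => Subtype.ext (DFunLike.congr_fun (map_one φQ) (x : Q))
      map_mul' := fun g h => MonoidHom.ext fun x =>
        Subtype.ext (DFunLike.congr_fun (map_mul φQ g h) (x : Q)) }
  refine mem_zpowers_of_fixedPointFree_comm (W := Subgroup.center Q) φ
    (fun g hg w hw => ?_) (fun h => hpN ?_) hzy hz hz1 hy
  · have h1 := hfix g hg (w : Q) (congrArg (fun x : Subgroup.center Q => ((x : Q) : N)) hw)
    exact Subtype.ext (Subtype.ext h1)
  · exact h.trans ((Subgroup.card_subgroup_dvd_card _).trans (Subgroup.card_subgroup_dvd_card _))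

end FixedPointFree

/-! ### Translation between cohomology classes and explicit cocycles. -/

section GroupCohomology

open groupCohomology

/-- `ℚ/ℤ` is an injective `ℤ`-module. -/
theorem baer_ulift_addCircle : Module.Baer ℤ (ULift.{u} (AddCircle (1 : ℚ))) := by
  let _ : DivisibleBy (ULift.{u} (AddCircle (1 : ℚ))) ℤ :=
    { div := fun a n => ⟨DivisibleBy.div a.down n⟩
      div_zero := fun a => ULift.ext _ _ (DivisibleBy.div_zero a.down)
      div_cancel := fun a hn => ULift.ext _ _ (DivisibleBy.div_cancel a.down hn) }
  exact Module.Baer.of_divisible _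

variable {G : Type u} [Group G]

theorem isTrivCocycle₂_of_mem_cocycles₂ (x : cocycles₂ (trivQModZ G)) :
    IsTrivCocycle₂ fun a b => (x (a, b) : ULift.{u} (AddCircle (1 : ℚ))) := fun g h j =>
  (mem_cocycles₂_iff x.1).1 x.2 g h j

theorem mem_coboundaries₂_iff_isTrivCoboundary₂ (f : G × G → trivQModZ G) :
    f ∈ coboundaries₂ (trivQModZ G) ↔
      IsTrivCoboundary₂ fun a b => (f (a, b) : ULift.{u} (AddCircle (1 : ℚ))) := by
  constructor
  · rintro ⟨y, rfl⟩
    refine ⟨y, fun g h => ?_⟩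
    change (y h : ULift.{u} (AddCircle (1 : ℚ))) - y (g * h) + y g = y g + y h - y (g * h)
    abel
  · rintro ⟨y, hy⟩
    refine ⟨y, funext fun ⟨g, h⟩ => ?_⟩
    refine Eq.trans ?_ (hy g h).symm
    change (y h : ULift.{u} (AddCircle (1 : ℚ))) - y (g * h) + y g = y g + y h - y (g * h)
    abel

theorem H2π_eq_zero_iff_isTrivCoboundary₂ (x : cocycles₂ (trivQModZ G)) :
    H2π (trivQModZ G) x = 0 ↔
      IsTrivCoboundary₂ fun a b => (x (a, b) : ULift.{u} (AddCircle (1 : ℚ))) := by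
  rw [H2π_eq_zero_iff, mem_coboundaries₂_iff_isTrivCoboundary₂]

theorem resH2_H2π_eq_zero_iff (A : Subgroup G) (x : cocycles₂ (trivQModZ G)) :
    resH2 A (H2π (trivQModZ G) x) = 0 ↔
      IsTrivCoboundary₂ fun a b : A => (x ((a : G), (b : G)) : ULift.{u} (AddCircle (1 : ℚ))) := by
  have h : resH2 A (H2π (trivQModZ G) x) = H2π (trivQModZ A) (mapCocycles₂ (A := trivQModZ G)
      (B := trivQModZ A) A.subtype (CategoryTheory.CategoryStruct.id (trivQModZ A)) x) :=
    H2π_comp_map_apply (A := trivQModZ G) (B := trivQModZ A) A.subtype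
      (CategoryTheory.CategoryStruct.id (trivQModZ A)) x
  rw [h, H2π_eq_zero_iff_isTrivCoboundary₂]
  rfl

theorem H2π_mem_bogomolovMultiplier_iff (x : cocycles₂ (trivQModZ G)) :
    H2π (trivQModZ G) x ∈ bogomolovMultiplier G ↔ ∀ A : Subgroup G, IsBicyclic A →
      IsTrivCoboundary₂ fun a b : A => (x ((a : G), (b : G)) : ULift.{u} (AddCircle (1 : ℚ))) := by
  simp only [bogomolovMultiplier, Submodule.mem_iInf, LinearMap.mem_ker]
  exact forall₂_congr fun A _ => resH2_H2π_eq_zero_iff A x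

theorem IsBicyclic.of_mulEquiv {A B : Type u} [Group A] [Group B] (e : A ≃* B)
    (h : IsBicyclic A) : IsBicyclic B := by
  rcases h with h | ⟨C, D, _, _, hC, hD, ⟨f⟩⟩
  · exact .inl (e.isCyclic.1 h)
  · exact .inr ⟨C, D, _, _, hC, hD, ⟨e.symm.trans f⟩⟩

/-- If `B₀(P) = 0` then a cocycle of `G` representing a class of `B₀(G)` becomes a coboundary when
pulled back along an injective homomorphism `P → G`. -/
theorem isTrivCoboundary₂_comp_of_bogomolovMultiplier_eq_bot {x : cocycles₂ (trivQModZ G)}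
    (hx : H2π (trivQModZ G) x ∈ bogomolovMultiplier G) {P : Type u} [Group P] (φ : P →* G)
    (hφ : Function.Injective φ) (hP : bogomolovMultiplier P = ⊥) :
    IsTrivCoboundary₂ fun a b : P => (x (φ a, φ b) : ULift.{u} (AddCircle (1 : ℚ))) := by
  rw [H2π_mem_bogomolovMultiplier_iff] at hx
  let y : cocycles₂ (trivQModZ P) := ⟨fun a => x (φ a.1, φ a.2),
    (mem_cocycles₂_iff _).2 ((isTrivCocycle₂_of_mem_cocycles₂ x).comp φ)⟩
  have hy : H2π (trivQModZ P) y ∈ bogomolovMultiplier P := by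
    rw [H2π_mem_bogomolovMultiplier_iff]
    intro A hA
    have h1 := hx (A.map φ) (hA.of_mulEquiv (A.equivMapOfInjective φ hφ))
    exact h1.comp (A.equivMapOfInjective φ hφ).toMonoidHom
  rw [hP, Submodule.mem_bot, H2π_eq_zero_iff_isTrivCoboundary₂] at hy
  exact hy

/-- Plays the role of corestriction after restriction being multiplication by the index. -/
theorem index_smul_H2π_eq_zero (x : cocycles₂ (trivQModZ G)) (H : Subgroup G) [H.FiniteIndex]
    (hH : IsTrivCoboundary₂ fun a b : H =>
      (x ((a : G), (b : G)) : ULift.{u} (AddCircle (1 : ℚ)))) :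
    H.index • H2π (trivQModZ G) x = 0 := by
  rw [← map_nsmul, H2π_eq_zero_iff_isTrivCoboundary₂]
  exact (isTrivCocycle₂_of_mem_cocycles₂ x).index_smul H hH

end GroupCohomology

/-! ### Frobenius groups and the choice of subgroup at each prime. -/

section Frobenius

variable {G : Type u} [Group G] {N G₀ : Subgroup G}

/-- The kernel and the complement of a Frobenius group have coprime orders. -/
theorem IsFrobeniusGroup.not_dvd_card_of_dvd_card_complement (hG : IsFrobeniusGroup N G₀) {p : ℕ}
    [hp : Fact p.Prime] (h : p ∣ Nat.card G₀) : ¬ p ∣ Nat.card N := by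
  intro hN
  have := hG.finite
  have := hG.normal
  obtain ⟨g, hg⟩ := exists_prime_orderOf_dvd_card' p h
  let P : Subgroup G₀ := Subgroup.zpowers g
  have hP : IsPGroup p P := IsPGroup.of_card (n := 1) (by rw [Nat.card_zpowers, hg, pow_one])
  let _ : MulDistribMulAction P N := MulDistribMulAction.compHom N
    ((MulAut.conjNormal (H := N)).comp (G₀.subtype.comp P.subtype))
  -- The number of fixed points is divisible by `p`, so `1` is not the only one.
  obtain ⟨b, hb, hb1⟩ := hP.exists_fixed_point_of_prime_dvd_card_of_fixed_point N hN (a := 1)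
    (fun g => smul_one g)
  refine hG.fixedPointFree b b.2 (fun h => hb1 (Subtype.ext h.symm)) g g.2 (fun h => ?_)
    (congrArg Subtype.val (hb ⟨g, Subgroup.mem_zpowers g⟩))
  rw [show g = 1 from Subtype.ext h, orderOf_one] at hg
  exact hp.out.one_lt.ne hg

/-- A cocycle representing a class of `B₀(G)` becomes a coboundary on some subgroup of index prime
to `p`. -/
theorem IsFrobeniusGroup.exists_subgroup_isTrivCoboundary₂ (hG : IsFrobeniusGroup N G₀)
    (hN : ∀ (p : ℕ) [Fact p.Prime] (P : Sylow p N), bogomolovMultiplier (P : Subgroup N) = ⊥)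
    (x : groupCohomology.cocycles₂ (trivQModZ G))
    (hx : groupCohomology.H2π (trivQModZ G) x ∈ bogomolovMultiplier G) (p : ℕ)
    [hp : Fact p.Prime] : ∃ H : Subgroup G, ¬ p ∣ H.index ∧ IsTrivCoboundary₂ fun a b : H =>
      (x ((a : G), (b : G)) : ULift.{u} (AddCircle (1 : ℚ))) := by
  have := hG.finite
  have := hG.normal
  by_cases hpN : p ∣ Nat.card N
  · let P : Sylow p N := default
    refine ⟨(N.subtype.comp (P : Subgroup N).subtype).range, fun h => ?_,
      isTrivCoboundary₂_range (f := fun a b => (x (a, b) : ULift.{u} (AddCircle (1 : ℚ))))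
      (N.subtype_injective.comp (P : Subgroup N).subtype_injective)
      (isTrivCoboundary₂_comp_of_bogomolovMultiplier_eq_bot hx _
        (N.subtype_injective.comp (P : Subgroup N).subtype_injective) (hN p P))⟩
    rw [MonoidHom.range_comp, Subgroup.range_subtype, Subgroup.index_map_subtype,
      hG.isComplement.symm.index_eq_card] at h
    rcases hp.out.dvd_mul.1 h with h | h
    · exact P.not_dvd_index h
    · exact hG.not_dvd_card_of_dvd_card_complement h hpN
  · let P : Sylow p G₀ := default
    have : Nontrivial N := (Subgroup.nontrivial_iff_ne_bot N).2 hG.kernel_ne_bot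
    let _ : MulDistribMulAction P N := MulDistribMulAction.compHom N
      ((MulAut.conjNormal (H := N)).comp (G₀.subtype.comp (P : Subgroup G₀).subtype))
    have hfix : ∀ g : P, g ≠ 1 → ∀ x : N, g • x = x → x = 1 := by
      intro g hg x hx
      by_contra hx1
      exact hG.fixedPointFree x x.2 (fun h => hx1 (Subtype.ext h)) (g : G₀) (g : G₀).2
        (fun h => hg (Subtype.ext (Subtype.ext h))) (congrArg Subtype.val hx)
    refine ⟨(G₀.subtype.comp (P : Subgroup G₀).subtype).range, fun h => ?_,
      isTrivCoboundary₂_range (f := fun a b => (x (a, b) : ULift.{u} (AddCircle (1 : ℚ))))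
      (G₀.subtype_injective.comp (P : Subgroup G₀).subtype_injective)
      (P.2.isTrivCoboundary₂ (fun z y hzy hz hz1 hy =>
        P.2.mem_zpowers_of_fixedPointFree hfix hpN hzy hz hz1 hy) baer_ulift_addCircle
        ((isTrivCocycle₂_of_mem_cocycles₂ x).comp _))⟩
    rw [MonoidHom.range_comp, Subgroup.range_subtype, Subgroup.index_map_subtype,
      hG.isComplement.index_eq_card] at h
    rcases hp.out.dvd_mul.1 h with h | h
    · exact P.not_dvd_index h
    · exact hpN h

end Frobenius

theorem mainTheorem12 {G : Type u} [Group G] (N G₀ : Subgroup G) (hG : IsFrobeniusGroup N G₀)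
    (hN : ∀ (p : ℕ) [Fact p.Prime] (P : Sylow p N),
      bogomolovMultiplier (P : Subgroup N) = ⊥) :
    bogomolovMultiplier G = ⊥ := by
  have := hG.finite
  rw [Submodule.eq_bot_iff]
  intro c hc
  induction c using groupCohomology.H2_induction_on with | h x => ?_
  by_contra hne
  -- `addOrderOf` could a priori be `0`; a prime still divides it, and the same contradiction
  -- follows.
  obtain ⟨p, hp, hpd⟩ := Nat.exists_prime_and_dvd fun h =>
    hne (AddMonoid.addOrderOf_eq_one_iff.1 h)
  have : Fact p.Prime := ⟨hp⟩
  obtain ⟨H, hH, hcob⟩ := hG.exists_subgroup_isTrivCoboundary₂ hN x hc p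
  exact hH (hpd.trans (addOrderOf_dvd_of_nsmul_eq_zero (index_smul_H2π_eq_zero x H hcob)))
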